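/- Let $N \ge 0$ and let $K$ be an abstract simplicial complex with vertex set $\{1,\dots,N\}$ (its simplices are nonempty). Let $|K| = \bigcup_{\sigma\in K}|\sigma| \subseteq \mathbb{R}^N$, where $|\sigma|$ is the convex hull of the standard unit vectors $e_i$, $i\in\sigma$. Let $P$ be the precubical set whose $n$-cubes are the pairs $(\tau,\sigma)$ of simplices of $K$ with $\tau\subseteq\sigma$ and $|\sigma\setminus\tau| = n$, with face maps $$d^0_i(\tau,\sigma) = (\tau,\sigma\setminus\{w_i\}),\qquad d^1_i(\tau,\sigma) = (\tau\cup\{w_i\},\sigma),\qquad \sigma\setminus\tau=\{w_1<\dots<w_n\},$$ and let $|P|$ be its geometric realization, the quotient space of $\coprod_n P_n\times[0,1]^n$ ($P_n$ discrete) by the equivalence relation generated by $(d^k_i x,u)\sim(x,\delta^k_i u)$, where $\delta^k_i$ inserts $k\in\{0,1\}$ at position $i$. For $\theta\in S_n$ let $\Delta_\theta = \{t\in[0,1]^n \mid t_{\theta(1)}\ge\dots\ge t_{\theta(n)}\}$. For an $n$-cube $(\tau,\sigma)$ of $P$ with $\sigma\setminus\tau=\{w_1<\dots<w_n\}$ and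 $r=|\tau|$, and for $t\in\Delta_\theta$, put $s_0=1$, $s_j=t_{\theta(j)}$ for $1\le j\le n$, $s_{n+1}=0$, and $$f_{\tau,\sigma}(t)=\sum_{j=0}^{n}\frac{s_j-s_{j+1}}{r+j}\Bigl(\sum_{v\in\tau}e_v+\sum_{i=1}^{j}e_{w_{\theta(i)}}\Bigr).$$ Theorem. (1) For every $n$, $[0,1]^n=\bigcup_{\theta\in S_n}\Delta_\theta$. (2) There is exactly one map $f\colon|P|\to|K|$ with $f([(\tau,\sigma),t])=f_{\tau,\sigma}(t)$ for all $n$, all $n$-cubes $(\tau,\sigma)$ of $P$, all $\theta\in S_n$ and all $t\in\Delta_\theta$; in particular, these formulas do not depend on the choice of $\theta$ and are compatible with the identifications in $|P|$. (3) This map $f$ is a homeomorphism. (4) For every $n$-cube $(\tau,\sigma)$ and every $\theta\in S_n$, the sets $\tau_j=\tau\cup\{w_{\theta(1)},\dots,w_{\theta(j)}\}$, $0\le j\le n$, are simplices of $K$ contained in $\sigma$, and $f$ maps $\{(\tau,\sigma)\}\times\Delta_\theta$ onto the set of all convex combinations of the barycenters $\frac{1}{|\tau_j|}\sum_{v\in\tau_j}e_v$,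 $0\le j\le n$. -/

import Mathlib

universe u

/-- A precubical set: a graded set with face maps `d^k_i : X_{n+1} → X_n`, where the direction
`k ∈ {0, 1}` is encoded by `Bool` (`false` is `0`, `true` is `1`) and the index `i` runs over
`Fin (n + 1)`. For zero-based `i ≤ j` the law reads `d^k_i ∘ d^l_{j+1} = d^l_j ∘ d^k_i`. -/
structure PrecubicalSet where
  cube : ℕ → Type u
  face : ∀ {n : ℕ}, Bool → Fin (n + 1) → cube (n + 1) → cube n
  face_face : ∀ {n : ℕ} (k l : Bool) (i j : Fin (n + 1)), i ≤ j → ∀ x : cube (n + 2),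
    face k i (face l j.succ x) = face l j (face k i.castSucc x)

namespace PrecubicalSet

/-- The map `δ^k_i : [0,1]^n → [0,1]^(n+1)` inserting the value `k` at position `i`. -/
def delta {n : ℕ} (k : Bool) (i : Fin (n + 1)) (u : Fin n → unitInterval) : Fin (n + 1) → unitInterval :=
  i.insertNth (α := fun _ => unitInterval) (if k then 1 else 0) u

variable (X : PrecubicalSet.{u})

/-- The topological sum of one cube `[0,1]^n` for each `x ∈ X_n`, `n ≥ 0`. It is the space
`∐ₙ X_n × [0,1]^n` with discrete `X_n`. -/
abbrev PreRealization : Type u :=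
  Σ x : (Σ n : ℕ, X.cube n), (Fin x.1 → unitInterval)

/-- The relation `(d^k_i x, u) ∼ (x, δ^k_i u)` that generates the gluing. -/
inductive FaceRel : X.PreRealization → X.PreRealization → Prop
  | glue {n : ℕ} (k : Bool) (i : Fin (n + 1)) (x : X.cube (n + 1)) (u : Fin n → unitInterval) :
      FaceRel ⟨⟨n, X.face k i x⟩, u⟩ ⟨⟨n + 1, x⟩, delta k i u⟩

/-- The geometric realization `|X|`: the quotient by the equivalence relation generated by
`FaceRel`, with the quotient topology. -/
def Realization : Type u := Quot X.FaceRel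

instance : TopologicalSpace X.Realization :=
  inferInstanceAs (TopologicalSpace (Quot X.FaceRel))

variable {X}

/-- The class `[x, u] ∈ |X|`. -/
def Realization.mk {n : ℕ} (x : X.cube n) (u : Fin n → unitInterval) : X.Realization :=
  Quot.mk X.FaceRel ⟨⟨n, x⟩, u⟩

end PrecubicalSet

/-- The simplex `Δ_θ = {t ∈ [0,1]^n | t_{θ(1)} ≥ ⋯ ≥ t_{θ(n)}}`. -/
def orderSimplex {n : ℕ} (θ : Equiv.Perm (Fin n)) : Set (Fin n → unitInterval) :=
  {t | Antitone fun i => t (θ i)}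

namespace AbstractSimplicialComplex

variable {N : ℕ} (K : AbstractSimplicialComplex (Fin N))

/-- The geometric simplex `|σ| ⊆ ℝ^N` with vertices `e_i`, `i ∈ σ`. -/
def geomSimplex (σ : Finset (Fin N)) : Set (Fin N → ℝ) :=
  convexHull ℝ ((fun i => Pi.single i (1 : ℝ)) '' (σ : Set (Fin N)))

/-- The polyhedron `|K| = ⋃_{σ ∈ K} |σ|`; as a type it has the subspace topology of `ℝ^N`. -/
def polyhedron : Set (Fin N → ℝ) := ⋃ σ ∈ K, geomSimplex σ

/-- The barycenter of `|σ|`. -/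
noncomputable def barycenter (σ : Finset (Fin N)) : Fin N → ℝ :=
  (σ.card : ℝ)⁻¹ • ∑ v ∈ σ, Pi.single v (1 : ℝ)

/-- The pairs `(τ, σ)` of simplices of `K` with `τ ⊆ σ` and `|σ \ τ| = n`. -/
@[ext]
structure SubdivCube (n : ℕ) where
  lower : Finset (Fin N)
  upper : Finset (Fin N)
  lower_mem : lower ∈ K
  upper_mem : upper ∈ K
  lower_subset : lower ⊆ upper
  card_sdiff : (upper \ lower).card = n

namespace SubdivCube

variable {K}

/-- The increasing enumeration `w_1 < ⋯ < w_n` of `σ \ τ`. -/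
def w {n : ℕ} (c : K.SubdivCube n) : Fin n ↪o Fin N :=
  (c.upper \ c.lower).orderEmbOfFin c.card_sdiff

theorem w_mem {n : ℕ} (c : K.SubdivCube n) (i : Fin n) : c.w i ∈ c.upper \ c.lower :=
  Finset.orderEmbOfFin_mem _ _ _

/-- The face `d^0_i (τ, σ) = (τ, σ \ {w_i})`. -/
def face0 {n : ℕ} (i : Fin (n + 1)) (c : K.SubdivCube (n + 1)) : K.SubdivCube n where
  lower := c.lower
  upper := c.upper.erase (c.w i)
  lower_mem := c.lower_mem
  lower_subset := fun v hv => Finset.mem_erase.2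
    ⟨fun h => (Finset.mem_sdiff.1 (c.w_mem i)).2 (h ▸ hv), c.lower_subset hv⟩
  upper_mem := by
    have hne : c.lower.Nonempty := (K.isRelLowerSet_faces c.lower_mem).1
    refine (K.isRelLowerSet_faces c.upper_mem).2 (Finset.erase_subset _ _) ?_
    obtain ⟨v, hv⟩ := hne
    exact ⟨v, Finset.mem_erase.2
      ⟨fun h => (Finset.mem_sdiff.1 (c.w_mem i)).2 (h ▸ hv), c.lower_subset hv⟩⟩
  card_sdiff := by
    rw [Finset.erase_sdiff_comm, Finset.card_erase_of_mem (c.w_mem i), c.card_sdiff]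
    rfl

/-- The face `d^1_i (τ, σ) = (τ ∪ {w_i}, σ)`. -/
def face1 {n : ℕ} (i : Fin (n + 1)) (c : K.SubdivCube (n + 1)) : K.SubdivCube n where
  lower := insert (c.w i) c.lower
  upper := c.upper
  lower_mem := (K.isRelLowerSet_faces c.upper_mem).2
    (Finset.insert_subset (Finset.mem_sdiff.1 (c.w_mem i)).1 c.lower_subset)
    (Finset.insert_nonempty _ _)
  upper_mem := c.upper_mem
  lower_subset := Finset.insert_subset (Finset.mem_sdiff.1 (c.w_mem i)).1 c.lower_subset
  card_sdiff := by
    rw [Finset.sdiff_insert, Finset.card_erase_of_mem (c.w_mem i), c.card_sdiff]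
    rfl

theorem w_eq_of_sdiff {n : ℕ} (i : Fin (n + 1)) (c : K.SubdivCube (n + 1)) (d : K.SubdivCube n)
    (h : d.upper \ d.lower = (c.upper \ c.lower).erase (c.w i)) (j : Fin n) :
    d.w j = c.w (i.succAbove j) := by
  have := Finset.orderEmbOfFin_unique d.card_sdiff (f := fun j => c.w (i.succAbove j))
    (fun j => by
      rw [h]
      exact Finset.mem_erase.2
        ⟨fun e => Fin.succAbove_ne i j (c.w.injective e), c.w_mem _⟩)
    (c.w.strictMono.comp (Fin.strictMono_succAbove i))
  exact (congrFun this j).symm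

theorem w_face0 {n : ℕ} (i : Fin (n + 1)) (c : K.SubdivCube (n + 1)) (j : Fin n) :
    (face0 i c).w j = c.w (i.succAbove j) :=
  w_eq_of_sdiff i c _ (Finset.erase_sdiff_comm _ _ _) j

theorem w_face1 {n : ℕ} (i : Fin (n + 1)) (c : K.SubdivCube (n + 1)) (j : Fin n) :
    (face1 i c).w j = c.w (i.succAbove j) :=
  w_eq_of_sdiff i c _ (Finset.sdiff_insert _ _ _) j

/-- The `j`-th simplex `τ ∪ {w_{θ(1)}, …, w_{θ(j)}}` of the flag from `τ` to `σ` determined by `θ`,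
for `j = 0, …, n`. -/
def flag {n : ℕ} (c : K.SubdivCube n) (θ : Equiv.Perm (Fin n)) (j : Fin (n + 1)) :
    Finset (Fin N) :=
  c.lower ∪ (Finset.univ.filter fun i : Fin n => i.castSucc < j).image fun i => c.w (θ i)

/-- For `t ∈ Δ_θ`, the value
`∑_{j = 0}^{n} (s_j - s_{j+1}) / (r + j) * (∑_{v ∈ τ} e_v + ∑_{i ≤ j} e_{w_{θ(i)}})`
where `r = |τ|`, `s_0 = 1`, `s_j = t_{θ(j)}` for `1 ≤ j ≤ n`, and `s_{n+1} = 0`. -/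
noncomputable def mapFormula {n : ℕ} (c : K.SubdivCube n) (θ : Equiv.Perm (Fin n))
    (t : Fin n → unitInterval) : Fin N → ℝ :=
  let s : Fin (n + 2) → ℝ :=
    Fin.cons (α := fun _ => ℝ) 1 (Fin.snoc (α := fun _ => ℝ) (fun i => (t (θ i) : ℝ)) 0)
  ∑ j : Fin (n + 1), ((s j.castSucc - s j.succ) / ((c.lower.card : ℝ) + (j : ℕ))) •
    (∑ v ∈ c.lower, Pi.single v (1 : ℝ) +
      ∑ i : Fin n with i.castSucc < j, Pi.single (c.w (θ i)) (1 : ℝ))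

end SubdivCube

/-- The cubical barycentric subdivision `P` of `K`. -/
def cubicalSubdivision : PrecubicalSet.{0} where
  cube := K.SubdivCube
  face := fun k i c => if k then SubdivCube.face1 i c else SubdivCube.face0 i c
  face_face := by
    intro n k l i j hij x
    have h1 : j.succ.succAbove i = i.castSucc :=
      Fin.succAbove_of_castSucc_lt _ _ (Fin.castSucc_lt_succ_iff.2 hij)
    have h2 : i.castSucc.succAbove j = j.succ :=
      Fin.succAbove_of_le_castSucc _ _ (Fin.castSucc_le_castSucc_iff.2 hij)
    have h0 : ∀ y : K.SubdivCube (n + 2),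
        (SubdivCube.face0 j.succ y).w i = y.w i.castSucc ∧
        (SubdivCube.face1 j.succ y).w i = y.w i.castSucc ∧
        (SubdivCube.face0 i.castSucc y).w j = y.w j.succ ∧
        (SubdivCube.face1 i.castSucc y).w j = y.w j.succ := fun y =>
      ⟨by rw [SubdivCube.w_face0, h1], by rw [SubdivCube.w_face1, h1],
        by rw [SubdivCube.w_face0, h2], by rw [SubdivCube.w_face1, h2]⟩
    obtain ⟨e1, e2, e3, e4⟩ := h0 x
    cases k <;> cases l <;> simp only [if_true, if_false, Bool.false_eq_true]
    · refine SubdivCube.ext rfl ?_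
      change (x.upper.erase _).erase _ = (x.upper.erase _).erase _
      rw [e1, e3, Finset.erase_right_comm]
    · refine SubdivCube.ext ?_ ?_
      · change insert _ x.lower = insert _ x.lower
        rw [e3]
      · change x.upper.erase _ = x.upper.erase _
        rw [e2]
    · refine SubdivCube.ext ?_ ?_
      · change insert _ x.lower = insert _ x.lower
        rw [e1]
      · change x.upper.erase _ = x.upper.erase _
        rw [e4]
    · refine SubdivCube.ext ?_ rfl
      change insert _ (insert _ x.lower) = insert _ (insert _ x.lower)
      rw [e2, e4, Finset.insert_comm]

variable {K}

/-- `f : |P| → |K|` is given on every simplex `Δ_θ` of every cube `(τ, σ)` by the formula above. -/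
def IsSubdivisionMap (f : K.cubicalSubdivision.Realization → K.polyhedron) : Prop :=
  ∀ (n : ℕ) (c : K.SubdivCube n) (θ : Equiv.Perm (Fin n)), ∀ t ∈ orderSimplex θ,
    (f (.mk (X := K.cubicalSubdivision) c t) : Fin N → ℝ) = c.mapFormula θ t

end AbstractSimplicialComplex

/-!
The homeomorphism is found by comparing `|P|` and `|K|` with the same set of vectors in `ℝ^N`.

A point `[(τ, σ), t]` of `|P|` has vertex coordinates (`SubdivCube.coords`): `1` on `τ`, `t_i` at
`w_i` and `0` outside `σ`. Gluing of faces does not change them, and they determine the point: it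
lies in the interior of some cube, whose `τ` and `σ` are the sets where the coordinates are `1` and
nonzero (`realizationCoords_injective`).

A point `x` of `|K|` is sent to the vector `minSum x` with entries `∑ u, min (x u) (x v)`. This map
is continuous, and it is injective because it preserves the order of the entries
(`minSum_injective`). The formula for `f` on `Δ_θ` is the convex combination of the barycenters of a
flag with weights `s_j - s_{j+1}` (`mapFormula_eq`). Since `min` acts termwise on nonnegative
combinations of indicator functions of a chain of sets (`minSum_chain`), applying `minSum` to it
gives back the vertex coordinates of the point (`minSum_mapFormula`). As these do not involve `θ` and
are compatible with the gluing, `f` is well defined, and it is characterized by `minSum ∘ f` being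
the vertex coordinates.

The spaces `|P|` and `|K|` are compact, so the injective map `minSum` embeds `|K|` and `f` is
continuous. It is injective because the vertex coordinates are, surjective because every `minSum x`
is the coordinate vector of some point of `|P|` (`exists_realizationCoords_eq`), and hence a
homeomorphism.
-/

/-! ### The map `minSum` -/

/-- The coordinatewise sum `v ↦ ∑ u, min (x u) (x v)`. On `|K|` it recovers the cube coordinates
of a point. -/
noncomputable def minSum {ι : Type*} [Fintype ι] (x : ι → ℝ) (v : ι) : ℝ :=
  ∑ u, min (x u) (x v)

theorem continuous_minSum {ι : Type*} [Fintype ι] :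
    Continuous (minSum : (ι → ℝ) → ι → ℝ) := by
  unfold minSum
  fun_prop

/-- If `x` and `y` have the same image, their entries are ordered alike; at the least entry where
they differ, the two sums then differ by a positive multiple of the difference of the entries. -/
theorem minSum_injective {ι : Type*} [Fintype ι] :
    Function.Injective (minSum : (ι → ℝ) → ι → ℝ) := by
  classical
  have mono : ∀ (x : ι → ℝ) (u v : ι), x u ≤ x v → minSum x u ≤ minSum x v := fun x u v h =>
    Finset.sum_le_sum fun i _ => min_le_min le_rfl h
  have smono : ∀ (x : ι → ℝ) (u v : ι), x u < x v → minSum x u < minSum x v := fun x u v h =>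
    Finset.sum_lt_sum (fun i _ => min_le_min le_rfl h.le)
      ⟨v, Finset.mem_univ v, by rw [min_self, min_eq_right h.le]; exact h⟩
  have key : ∀ (x : ι → ℝ) (u v : ι), minSum x u < minSum x v ↔ x u < x v := fun x u v =>
    ⟨fun h => by by_contra! h'; exact absurd (mono x v u h') (not_le.2 h), smono x u v⟩
  intro x y hxy
  have ord : ∀ u v, x u < x v ↔ y u < y v := fun u v => by rw [← key x, ← key y, hxy]
  by_contra hne
  -- Among the coordinates where `x` and `y` differ, take one with the least value of `x`.
  obtain ⟨v, hv, hmin⟩ := Finset.exists_min_image (Finset.univ.filter fun v => x v ≠ y v) x (by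
    obtain ⟨v, hv⟩ := Function.ne_iff.1 hne
    exact ⟨v, by simpa using hv⟩)
  simp only [Finset.mem_filter, Finset.mem_univ, true_and] at hv hmin
  have hsum := congrFun hxy v
  have hterm : ∀ u, min (x u) (x v) - min (y u) (y v) =
      if x u < x v then 0 else x v - y v := by
    intro u
    split_ifs with h
    · have : x u = y u := by
        by_contra h'
        exact absurd (hmin u h') (not_le.2 h)
      rw [min_eq_left h.le, min_eq_left ((ord u v).1 h).le, this, sub_self]
    · rw [min_eq_right (not_lt.1 h), min_eq_right (not_lt.1 (mt (ord u v).2 h))]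
  have : ∑ u, (if x u < x v then 0 else x v - y v) = 0 := by
    simp only [← hterm, Finset.sum_sub_distrib]
    exact sub_eq_zero.2 hsum
  rw [Finset.sum_ite, Finset.sum_const_zero, zero_add, Finset.sum_const, nsmul_eq_mul,
    mul_eq_zero, sub_eq_zero, Nat.cast_eq_zero, Finset.card_eq_zero] at this
  refine this.elim (fun h => ?_) hv
  exact Finset.notMem_empty v (h ▸ Finset.mem_filter.2 ⟨Finset.mem_univ v, lt_irrefl _⟩)

/-! ### Convex combinations and telescoping sums -/

theorem mem_convexHull_range_iff {ι E : Type*} [Fintype ι] [AddCommGroup E] [Module ℝ E]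
    (b : ι → E) (x : E) :
    x ∈ convexHull ℝ (Set.range b) ↔
      ∃ a : ι → ℝ, (∀ i, 0 ≤ a i) ∧ ∑ i, a i = 1 ∧ ∑ i, a i • b i = x := by
  classical
  constructor
  · have h := (Fintype.linearCombination ℝ b).image_convexHull
      (Set.range fun i : ι => Pi.single i (1 : ℝ))
    rw [convexHull_rangle_single_eq_stdSimplex, ← Set.range_comp] at h
    have e : (⇑(Fintype.linearCombination ℝ b) ∘ fun i : ι => Pi.single i (1 : ℝ)) = b := by
      ext i
      simp [Fintype.linearCombination_apply]
    rw [e] at h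
    rw [← h]
    rintro ⟨a, ha, rfl⟩
    exact ⟨a, ha.1, ha.2, rfl⟩
  · rintro ⟨a, h0, h1, rfl⟩
    exact mem_convexHull_of_exists_fintype a b h0 h1 (fun i => Set.mem_range_self i) rfl

/-- Tails of a telescoping sum. -/
theorem sum_sub_succ_tail {m : ℕ} (s : Fin (m + 1) → ℝ) (k : Fin (m + 1)) :
    (∑ j : Fin m, if k ≤ j.castSucc then s j.castSucc - s j.succ else 0) =
      s k - s (Fin.last m) := by
  induction m with
  | zero =>
    obtain rfl : k = Fin.last 0 := Fin.fin_one_eq_zero k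
    simp
  | succ m ih =>
    have h := ih (fun i => s i.succ)
    rw [Fin.sum_univ_succ]
    cases k using Fin.cases with
    | zero =>
      have h0 := h 0
      simp only [Fin.zero_le, if_true, Fin.succ_last, Fin.castSucc_zero,
        ← Fin.succ_castSucc] at h0 ⊢
      rw [h0]
      ring
    | succ k =>
      have h0 := h k
      simp only [Fin.succ_last] at h0
      simp only [← Fin.succ_castSucc, Fin.succ_le_succ_iff, h0, Fin.castSucc_zero,
        Fin.le_zero_iff, Fin.succ_ne_zero, if_false, zero_add]

/-! ### Chains and order simplices -/

/-- Minima commute with nonnegative combinations of the indicator functions of a chain of sets, so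
`minSum` of the combination of barycenters with weights `a j` is, at `v`, the sum of the weights of
the sets that contain `v`. -/
theorem minSum_chain {ι κ : Type*} [Fintype ι] [DecidableEq ι] [Fintype κ] [LinearOrder κ]
    (A : κ → Finset ι) (hA : Monotone A) (hne : ∀ j, (A j).Nonempty) (a : κ → ℝ)
    (ha : ∀ j, 0 ≤ a j) (v : ι) :
    minSum (fun u => ∑ j, if u ∈ A j then a j / (A j).card else 0) v =
      ∑ j, if v ∈ A j then a j else 0 := by
  have hpos : ∀ j, 0 ≤ a j / (A j).card := fun j => div_nonneg (ha j) (Nat.cast_nonneg _)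
  have hmin : ∀ u, min (∑ j, if u ∈ A j then a j / (A j).card else 0)
      (∑ j, if v ∈ A j then a j / (A j).card else 0) =
      ∑ j, if u ∈ A j then (if v ∈ A j then a j / (A j).card else 0) else 0 := by
    intro u
    have hle : ∀ p q : ι, (∀ j, p ∈ A j → q ∈ A j) →
        (∑ j, if p ∈ A j then a j / (A j).card else 0) ≤
          ∑ j, if q ∈ A j then a j / (A j).card else 0 := fun p q h =>
      Finset.sum_le_sum fun j _ => by
        by_cases hp : p ∈ A j
        · simp [hp, h j hp]
        · rw [if_neg hp]
          split_ifs
          exacts [hpos j, le_rfl]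
    -- The sets of indices `j` with `u ∈ A j` and with `v ∈ A j` are nested.
    have hnest : (∀ j, u ∈ A j → v ∈ A j) ∨ (∀ j, v ∈ A j → u ∈ A j) := by
      by_contra! h
      obtain ⟨⟨i, hui, hvi⟩, j, hvj, huj⟩ := h
      rcases le_total i j with hij | hij
      · exact huj (hA hij hui)
      · exact hvi (hA hij hvj)
    rcases hnest with h | h
    · rw [min_eq_left (hle u v h)]
      refine Finset.sum_congr rfl fun j _ => ?_
      by_cases hu : u ∈ A j
      · simp [hu, h j hu]
      · simp [hu]
    · rw [min_eq_right (hle v u h)]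
      refine Finset.sum_congr rfl fun j _ => ?_
      by_cases hv : v ∈ A j
      · simp [hv, h j hv]
      · simp [hv]
  unfold minSum
  simp only [hmin]
  rw [Finset.sum_comm]
  refine Finset.sum_congr rfl fun j _ => ?_
  have hc : ((A j).card : ℝ) ≠ 0 := by exact_mod_cast (hne j).card_pos.ne'
  rw [Finset.sum_ite_mem, Finset.univ_inter, Finset.sum_const, nsmul_eq_mul]
  split_ifs
  · field_simp
  · simp

theorem iUnion_orderSimplex (n : ℕ) :
    (⋃ θ : Equiv.Perm (Fin n), orderSimplex θ) = Set.univ := by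
  refine Set.eq_univ_of_forall fun t => Set.mem_iUnion.2 ⟨Tuple.sort (OrderDual.toDual ∘ t), ?_⟩
  intro i j hij
  exact Tuple.monotone_sort (OrderDual.toDual ∘ t) hij

namespace AbstractSimplicialComplex

variable {N : ℕ} {K : AbstractSimplicialComplex (Fin N)}

/-! ### The polyhedron and barycenters -/

theorem mem_geomSimplex_iff {σ : Finset (Fin N)} {x : Fin N → ℝ} :
    x ∈ geomSimplex σ ↔ (∀ v, 0 ≤ x v) ∧ ∑ v, x v = 1 ∧ ∀ v ∉ σ, x v = 0 := by
  constructor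
  · intro hx
    refine ⟨?_, ?_⟩
    · have : geomSimplex σ ⊆ stdSimplex ℝ (Fin N) := by
        rw [← convexHull_rangle_single_eq_stdSimplex]
        exact convexHull_mono (Set.image_subset_range _ _)
      exact (this hx).1
    · have : geomSimplex σ ⊆ {x : Fin N → ℝ | ∑ v, x v = 1 ∧ ∀ v ∉ σ, x v = 0} := by
        refine convexHull_min ?_ ?_
        · rintro _ ⟨i, hi, rfl⟩
          refine ⟨by simp, fun v hv => Pi.single_eq_of_ne ?_ _⟩
          rintro rfl
          exact hv hi
        · rintro x ⟨hx, hx'⟩ y ⟨hy, hy'⟩ a b _ _ hab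
          refine ⟨?_, fun v hv => by simp [hx' v hv, hy' v hv]⟩
          simp [Finset.sum_add_distrib, ← Finset.mul_sum, hx, hy, hab]
      exact this hx
  · rintro ⟨h0, h1, hσ⟩
    have hs : ∀ g : Fin N → ℝ, (∀ v ∉ σ, g v = 0) → ∑ v : σ, g v = ∑ v, g v := fun g hg => by
      rw [Finset.sum_coe_sort σ g]
      exact Finset.sum_subset (Finset.subset_univ σ) fun v _ hv => hg v hv
    refine mem_convexHull_of_exists_fintype (ι := σ) (fun v => x v)
      (fun v => Pi.single (v : Fin N) (1 : ℝ)) (fun v => h0 v) ((hs x hσ).trans h1)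
      (fun v => ⟨v, v.2, rfl⟩) ?_
    ext u
    have := hs (fun v => (x v • Pi.single (v : Fin N) (1 : ℝ) : Fin N → ℝ) u)
      (fun v hv => by simp [hσ v hv])
    rw [Finset.sum_apply]
    refine this.trans ?_
    simp [Pi.single_apply]

theorem isCompact_polyhedron (K : AbstractSimplicialComplex (Fin N)) :
    IsCompact K.polyhedron := by
  have h : ∀ σ : Finset (Fin N), IsCompact (geomSimplex σ) := fun σ =>
    (σ.finite_toSet.image _).isCompact_convexHull ℝ
  exact (Set.toFinite {σ | σ ∈ K}).isCompact_biUnion fun σ _ => h σ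

theorem sum_single_apply (σ : Finset (Fin N)) (v : Fin N) :
    (∑ u ∈ σ, Pi.single u (1 : ℝ) : Fin N → ℝ) v = if v ∈ σ then 1 else 0 := by
  simp [Finset.sum_apply, Pi.single_apply]

theorem barycenter_apply (σ : Finset (Fin N)) (v : Fin N) :
    barycenter σ v = if v ∈ σ then (σ.card : ℝ)⁻¹ else 0 := by
  rw [barycenter, Pi.smul_apply, sum_single_apply]
  simp

/-! ### Flags of a cube -/

namespace SubdivCube

variable {n : ℕ} (c : K.SubdivCube n) (θ : Equiv.Perm (Fin n))

theorem mem_flag {j : Fin (n + 1)} {v : Fin N} :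
    v ∈ c.flag θ j ↔ v ∈ c.lower ∨ ∃ i : Fin n, i.castSucc < j ∧ c.w (θ i) = v := by
  simp [flag]

theorem w_notMem_lower (i : Fin n) : c.w i ∉ c.lower := (Finset.mem_sdiff.1 (c.w_mem i)).2

theorem w_mem_upper (i : Fin n) : c.w i ∈ c.upper := (Finset.mem_sdiff.1 (c.w_mem i)).1

theorem exists_w_eq {v : Fin N} (hu : v ∈ c.upper) (hl : v ∉ c.lower) : ∃ i, c.w i = v := by
  have h := Finset.range_orderEmbOfFin (c.upper \ c.lower) c.card_sdiff
  have hv : v ∈ ((c.upper \ c.lower : Finset (Fin N)) : Set (Fin N)) := by simp [hu, hl]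
  rw [← h] at hv
  exact hv

theorem lower_nonempty : c.lower.Nonempty := (K.isRelLowerSet_faces c.lower_mem).1

theorem flag_mono : Monotone (c.flag θ) := fun j k hjk v hv => by
  rw [mem_flag] at hv ⊢
  exact hv.imp_right fun ⟨i, hi, h⟩ => ⟨i, hi.trans_le hjk, h⟩

theorem lower_subset_flag (j : Fin (n + 1)) : c.lower ⊆ c.flag θ j := Finset.subset_union_left

theorem flag_nonempty (j : Fin (n + 1)) : (c.flag θ j).Nonempty :=
  c.lower_nonempty.mono (c.lower_subset_flag θ j)

theorem flag_subset_upper (j : Fin (n + 1)) : c.flag θ j ⊆ c.upper := fun v hv => by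
  rcases (c.mem_flag θ).1 hv with h | ⟨i, -, rfl⟩
  exacts [c.lower_subset h, c.w_mem_upper _]

theorem flag_mem (j : Fin (n + 1)) : c.flag θ j ∈ K :=
  (K.isRelLowerSet_faces c.upper_mem).2 (c.flag_subset_upper θ j) (c.flag_nonempty θ j)

theorem disjoint_lower_image (j : Fin (n + 1)) : Disjoint c.lower
    ((Finset.univ.filter fun i : Fin n => i.castSucc < j).image fun i => c.w (θ i)) := by
  rw [Finset.disjoint_right]
  intro v hv
  obtain ⟨i, -, rfl⟩ := Finset.mem_image.1 hv
  exact c.w_notMem_lower _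

theorem card_flag (j : Fin (n + 1)) : (c.flag θ j).card = c.lower.card + j := by
  rw [flag, Finset.card_union_of_disjoint (c.disjoint_lower_image θ j),
    Finset.card_image_of_injective _ (f := fun i => c.w (θ i)) (c.w.injective.comp θ.injective)]
  congr 1
  have : (Finset.univ.filter fun i : Fin n => i.castSucc < j).map Fin.castSuccEmb =
      Finset.Iio j := by
    ext k
    simp only [Finset.mem_map, Finset.mem_filter, Finset.mem_univ, true_and, Finset.mem_Iio]
    constructor
    · rintro ⟨i, hi, rfl⟩
      exact hi
    · intro hk
      exact ⟨k.castLT (by have := j.2; have : (k : ℕ) < j := hk; omega), hk, rfl⟩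
  rw [← Finset.card_map Fin.castSuccEmb, this, Fin.card_Iio]

theorem sum_flag_single (j : Fin (n + 1)) :
    (∑ v ∈ c.flag θ j, Pi.single v (1 : ℝ) : Fin N → ℝ) =
      ∑ v ∈ c.lower, Pi.single v (1 : ℝ) +
        ∑ i : Fin n with i.castSucc < j, Pi.single (c.w (θ i)) (1 : ℝ) := by
  rw [flag, Finset.sum_union (c.disjoint_lower_image θ j),
    Finset.sum_image fun _ _ _ _ h => θ.injective (c.w.injective h)]

/-! ### Barycentric weights of a point of `Δ_θ` -/

/-- The sequence `s_0 = 1, s_j = t_{θ(j)}, s_{n+1} = 0`. As `Fin n` counts from zero, the entry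
`t (θ i)` has index `i.castSucc.succ`. -/
noncomputable def levels {n : ℕ} (θ : Equiv.Perm (Fin n)) (t : Fin n → unitInterval) :
    Fin (n + 2) → ℝ :=
  Fin.cons (α := fun _ => ℝ) 1 (Fin.snoc (α := fun _ => ℝ) (fun i => (t (θ i) : ℝ)) 0)

theorem levels_zero (t : Fin n → unitInterval) : levels θ t 0 = 1 := rfl

theorem levels_last (t : Fin n → unitInterval) : levels θ t (Fin.last (n + 1)) = 0 := by
  rw [levels, ← Fin.succ_last, Fin.cons_succ, Fin.snoc_last]

theorem levels_succ_castSucc (t : Fin n → unitInterval) (i : Fin n) :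
    levels θ t i.castSucc.succ = t (θ i) := by
  rw [levels, Fin.cons_succ, Fin.snoc_castSucc]

theorem levels_mem (t : Fin n → unitInterval) (k : Fin (n + 2)) :
    levels θ t k ∈ unitInterval := by
  cases k using Fin.cases with
  | zero => exact ⟨zero_le_one, le_rfl⟩
  | succ k =>
    cases k using Fin.lastCases with
    | last =>
      rw [Fin.succ_last, levels_last]
      exact ⟨le_rfl, zero_le_one⟩
    | cast i =>
      rw [levels_succ_castSucc]
      exact (t _).2

variable {θ}

theorem levels_antitone {t : Fin n → unitInterval} (ht : t ∈ orderSimplex θ) :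
    Antitone (levels θ t) := by
  intro k l hkl
  cases k using Fin.cases with
  | zero => exact (levels_mem θ t l).2
  | succ k =>
    cases l using Fin.cases with
    | zero => exact absurd hkl (by simp)
    | succ l =>
      rw [Fin.succ_le_succ_iff] at hkl
      cases l using Fin.lastCases with
      | last =>
        rw [Fin.succ_last, levels_last]
        exact (levels_mem θ t _).1
      | cast l =>
        cases k using Fin.lastCases with
        | last => exact absurd hkl (by simp [Fin.le_def])
        | cast k =>
          rw [levels_succ_castSucc, levels_succ_castSucc]
          exact ht (Fin.castSucc_le_castSucc_iff.1 hkl)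

/-- The barycentric weights `s_j - s_{j+1}` of the image of `t`. -/
noncomputable def weight (θ : Equiv.Perm (Fin n)) (t : Fin n → unitInterval) (j : Fin (n + 1)) :
    ℝ :=
  levels θ t j.castSucc - levels θ t j.succ

theorem weight_nonneg {t : Fin n → unitInterval} (ht : t ∈ orderSimplex θ) (j : Fin (n + 1)) :
    0 ≤ weight θ t j :=
  sub_nonneg.2 (levels_antitone ht (Fin.castSucc_le_succ j))

theorem sum_weight_tail (θ : Equiv.Perm (Fin n)) (t : Fin n → unitInterval) (k : Fin (n + 2)) :
    (∑ j, if k ≤ j.castSucc then weight θ t j else 0) = levels θ t k := by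
  have h := sum_sub_succ_tail (levels θ t) k
  rwa [levels_last, sub_zero] at h

theorem sum_weight (θ : Equiv.Perm (Fin n)) (t : Fin n → unitInterval) :
    ∑ j, weight θ t j = 1 := by
  simpa [levels_zero] using sum_weight_tail θ t 0

theorem mapFormula_eq (t : Fin n → unitInterval) :
    c.mapFormula θ t = ∑ j, weight θ t j • barycenter (c.flag θ j) := by
  refine Finset.sum_congr rfl fun j _ => ?_
  rw [barycenter, sum_flag_single, smul_smul, card_flag, Nat.cast_add, ← div_eq_mul_inv]
  rfl

/-! ### Vertex coordinates on a cube -/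

/-- The vertex coordinates of a point of a cube: the vertices of `τ` get `1`, the vertex `w_i`
gets `t_i`, and the vertices outside `σ` get `0`. They do not change under the gluing of
faces. -/
noncomputable def coords (t : Fin n → unitInterval) (v : Fin N) : ℝ :=
  if v ∈ c.lower then 1 else Function.extend c.w (fun i => (t i : ℝ)) 0 v

theorem coords_lower {t : Fin n → unitInterval} {v : Fin N} (hv : v ∈ c.lower) :
    c.coords t v = 1 := if_pos hv

theorem coords_w (t : Fin n → unitInterval) (i : Fin n) : c.coords t (c.w i) = t i := by
  rw [coords, if_neg (c.w_notMem_lower i), c.w.injective.extend_apply]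

theorem coords_of_notMem {t : Fin n → unitInterval} {v : Fin N} (hv : v ∉ c.upper) :
    c.coords t v = 0 := by
  rw [coords, if_neg fun h => hv (c.lower_subset h), Function.extend_apply']
  · rfl
  · rintro ⟨i, rfl⟩
    exact hv (c.w_mem_upper i)

/-- A vertex is in `τ`, in `σ \ τ`, or outside `σ`. -/
theorem vertex_cases (v : Fin N) : v ∈ c.lower ∨ (∃ i, c.w i = v) ∨ v ∉ c.upper := by
  by_cases hu : v ∈ c.upper
  · by_cases hl : v ∈ c.lower
    exacts [.inl hl, .inr (.inl (c.exists_w_eq hu hl))]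
  · exact .inr (.inr hu)

theorem continuous_coords : Continuous c.coords := by
  refine continuous_pi fun v => ?_
  rcases c.vertex_cases v with hv | ⟨i, rfl⟩ | hv
  · simp only [c.coords_lower hv]
    exact continuous_const
  · simp only [coords_w]
    fun_prop
  · simp only [c.coords_of_notMem hv]
    exact continuous_const

theorem w_mem_flag_iff {θ : Equiv.Perm (Fin n)} {i : Fin n} {j : Fin (n + 1)} :
    c.w (θ i) ∈ c.flag θ j ↔ i.castSucc < j := by
  rw [mem_flag, or_iff_right (c.w_notMem_lower _)]
  exact ⟨fun ⟨k, hk, h⟩ => θ.injective (c.w.injective h) ▸ hk, fun h => ⟨i, h, rfl⟩⟩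

/-- The formula for `f` inverts `minSum`. -/
theorem minSum_mapFormula {t : Fin n → unitInterval} (ht : t ∈ orderSimplex θ) :
    minSum (c.mapFormula θ t) = c.coords t := by
  ext v
  have h : c.mapFormula θ t =
      fun u => ∑ j, if u ∈ c.flag θ j then weight θ t j / (c.flag θ j).card else 0 := by
    ext u
    rw [mapFormula_eq, Finset.sum_apply]
    simp [barycenter_apply, div_eq_mul_inv]
  rw [h, minSum_chain (c.flag θ) (c.flag_mono θ) (c.flag_nonempty θ) _ (weight_nonneg ht)]
  rcases c.vertex_cases v with hv | ⟨i, rfl⟩ | hv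
  · simp [c.lower_subset_flag θ _ hv, sum_weight, c.coords_lower hv]
  · obtain ⟨i, rfl⟩ := θ.surjective i
    rw [coords_w, ← levels_succ_castSucc θ t i, ← sum_weight_tail θ t]
    refine Finset.sum_congr rfl fun j _ => ?_
    simp only [w_mem_flag_iff, Fin.succ_le_castSucc_iff]
  · rw [coords_of_notMem c hv]
    exact Finset.sum_eq_zero fun j _ => if_neg fun h => hv (c.flag_subset_upper θ j h)

/-! ### The image of `Δ_θ` -/

theorem barycenter_mem_geomSimplex {σ ρ : Finset (Fin N)} (hσ : σ.Nonempty) (h : σ ⊆ ρ) :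
    barycenter σ ∈ geomSimplex ρ := by
  refine mem_geomSimplex_iff.2 ⟨fun v => ?_, ?_, fun v hv => ?_⟩
  · rw [barycenter_apply]
    positivity
  · simp [barycenter_apply, hσ.card_pos.ne']
  · rw [barycenter_apply, if_neg fun hv' => hv (h hv')]

theorem mapFormula_image (θ : Equiv.Perm (Fin n)) :
    c.mapFormula θ '' orderSimplex θ =
      convexHull ℝ (Set.range fun j => barycenter (c.flag θ j)) := by
  ext x
  rw [mem_convexHull_range_iff]
  constructor
  · rintro ⟨t, ht, rfl⟩
    exact ⟨weight θ t, weight_nonneg ht, sum_weight θ t, (c.mapFormula_eq t).symm⟩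
  · rintro ⟨a, h0, h1, rfl⟩
    -- The coordinates are the tails of the weights.
    let s : Fin (n + 2) → ℝ := fun k => ∑ j, if k ≤ j.castSucc then a j else 0
    have hanti : Antitone s := fun k l hkl => Finset.sum_le_sum fun j _ => by
      by_cases h : l ≤ j.castSucc
      · rw [if_pos h, if_pos (hkl.trans h)]
      · rw [if_neg h]
        split_ifs
        exacts [h0 j, le_rfl]
    have hs0 : s 0 = 1 := by simpa [s] using h1
    have hsl : s (Fin.last (n + 1)) = 0 := Finset.sum_eq_zero fun j _ =>
      if_neg (not_le.2 (Fin.castSucc_lt_last j))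
    have hs : ∀ k, s k ∈ unitInterval := fun k =>
      ⟨hsl ▸ hanti (Fin.le_last k), hs0 ▸ hanti (Fin.zero_le k)⟩
    let t : Fin n → unitInterval := fun i => ⟨s (θ.symm i).castSucc.succ, hs _⟩
    have hlev : levels θ t = s := by
      ext k
      cases k using Fin.cases with
      | zero => exact hs0.symm
      | succ k =>
        cases k using Fin.lastCases with
        | last => rw [Fin.succ_last, levels_last, hsl]
        | cast i =>
          rw [levels_succ_castSucc]
          simp [t]
    refine ⟨t, fun i j hij => ?_, ?_⟩
    · change s _ ≤ s _
      simp only [Equiv.symm_apply_apply]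
      exact hanti (by simpa using hij)
    · rw [mapFormula_eq]
      refine Finset.sum_congr rfl fun j _ => ?_
      congr 1
      rw [weight, hlev]
      simp only [s]
      rw [← Finset.sum_sub_distrib, Finset.sum_eq_single j]
      · simp
      · intro i _ hij
        have : j.castSucc ≤ i.castSucc ↔ j.succ ≤ i.castSucc := by
          rw [Fin.succ_le_castSucc_iff, Fin.castSucc_le_castSucc_iff]
          exact ⟨fun h => lt_of_le_of_ne h hij.symm, le_of_lt⟩
        simp only [this, sub_self]
      · simp

theorem mapFormula_mem {t : Fin n → unitInterval} (ht : t ∈ orderSimplex θ) :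
    c.mapFormula θ t ∈ K.polyhedron := by
  refine Set.mem_biUnion c.upper_mem ?_
  have h : c.mapFormula θ t ∈ c.mapFormula θ '' orderSimplex θ := Set.mem_image_of_mem _ ht
  rw [mapFormula_image] at h
  refine convexHull_min ?_ (convex_convexHull ℝ _) h
  rintro _ ⟨j, rfl⟩
  exact barycenter_mem_geomSimplex (c.flag_nonempty θ j) (c.flag_subset_upper θ j)

/-- The face `d^k_i c`. -/
def face (k : Bool) (i : Fin (n + 1)) (c : K.SubdivCube (n + 1)) : K.SubdivCube n :=
  if k then face1 i c else face0 i c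

end SubdivCube

open SubdivCube PrecubicalSet

/-! ### Vertex coordinates on the realization -/

theorem coords_face {n : ℕ} (k : Bool) (i : Fin (n + 1)) (c : K.SubdivCube (n + 1))
    (u : Fin n → unitInterval) : (face k i c).coords u = c.coords (delta k i u) := by
  have hw : ∀ j, (face k i c).w j = c.w (i.succAbove j) := by
    cases k
    exacts [w_face0 i c, w_face1 i c]
  ext v
  rcases c.vertex_cases v with hv | ⟨j, rfl⟩ | hv
  · rw [c.coords_lower hv, coords_lower]
    cases k
    exacts [hv, Finset.mem_insert_of_mem hv]
  · rw [coords_w]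
    cases j using Fin.succAboveCases i with
    | x =>
      cases k
      · rw [coords_of_notMem]
        · simp [delta]
        · exact Finset.notMem_erase _ _
      · rw [coords_lower]
        · simp [delta]
        · exact Finset.mem_insert_self _ _
    | p j =>
      rw [← hw, coords_w]
      simp [delta]
  · rw [c.coords_of_notMem hv, coords_of_notMem]
    cases k
    exacts [fun h => hv (Finset.mem_of_mem_erase h), hv]

/-- The vertex coordinates of a point of `|P|`. -/
noncomputable def realizationCoords (p : K.cubicalSubdivision.Realization) : Fin N → ℝ :=
  Quot.lift (fun p : K.cubicalSubdivision.PreRealization => SubdivCube.coords p.1.2 p.2)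
    (by
      rintro _ _ ⟨k, i, x, u⟩
      exact coords_face k i x u) p

theorem realizationCoords_mk {n : ℕ} (c : K.SubdivCube n) (t : Fin n → unitInterval) :
    realizationCoords (.mk (X := K.cubicalSubdivision) c t) = c.coords t := rfl

theorem continuous_realizationCoords :
    Continuous (realizationCoords : K.cubicalSubdivision.Realization → Fin N → ℝ) :=
  continuous_quot_lift _ (continuous_sigma fun x => SubdivCube.continuous_coords x.2)

theorem mk_delta {n : ℕ} (k : Bool) (i : Fin (n + 1)) (c : K.SubdivCube (n + 1))
    (u : Fin n → unitInterval) :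
    Realization.mk (X := K.cubicalSubdivision) c (delta k i u) =
      .mk (X := K.cubicalSubdivision) (SubdivCube.face k i c) u :=
  (Quot.sound (FaceRel.glue (X := K.cubicalSubdivision) k i c u)).symm

/-- Every point of `|P|` lies in the interior of a cube. -/
theorem exists_interior_rep (p : K.cubicalSubdivision.Realization) :
    ∃ (n : ℕ) (c : K.SubdivCube n) (t : Fin n → unitInterval), (∀ i, t i ≠ 0 ∧ t i ≠ 1) ∧
      p = .mk (X := K.cubicalSubdivision) c t := by
  suffices h : ∀ (n : ℕ) (c : K.SubdivCube n) (t : Fin n → unitInterval),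
      ∃ (m : ℕ) (d : K.SubdivCube m) (u : Fin m → unitInterval), (∀ i, u i ≠ 0 ∧ u i ≠ 1) ∧
        Realization.mk (X := K.cubicalSubdivision) c t =
          .mk (X := K.cubicalSubdivision) d u by
    obtain ⟨⟨n, c⟩, t⟩ := p
    exact h n c t
  intro n
  induction n with
  | zero => exact fun c t => ⟨0, c, t, fun i => i.elim0, rfl⟩
  | succ n ih =>
    intro c t
    by_cases h : ∀ i, t i ≠ 0 ∧ t i ≠ 1
    · exact ⟨n + 1, c, t, h, rfl⟩
    · obtain ⟨k, i, hk⟩ : ∃ (k : Bool) (i : Fin (n + 1)), t i = if k then 1 else 0 := by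
        by_contra! h'
        exact h fun i => ⟨by simpa using h' false i, by simpa using h' true i⟩
      -- A coordinate equal to `0` or `1` means that the point lies on a face.
      have ht : t = delta k i fun j => t (i.succAbove j) := by
        rw [delta, ← hk]
        exact (Fin.insertNth_self_removeNth i t).symm
      obtain ⟨m, d, u, hu, e⟩ := ih (SubdivCube.face k i c) fun j => t (i.succAbove j)
      exact ⟨m, d, u, hu, by rw [← e, ← mk_delta, ← ht]⟩

/-- At an interior point of a cube no `w_i` has coordinate `1`. -/
theorem mem_lower_iff_coords {n : ℕ} (c : K.SubdivCube n) {t : Fin n → unitInterval}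
    (ht : ∀ i, t i ≠ 0 ∧ t i ≠ 1) (v : Fin N) : v ∈ c.lower ↔ c.coords t v = 1 := by
  refine ⟨c.coords_lower, fun h => ?_⟩
  rcases c.vertex_cases v with hv | ⟨i, rfl⟩ | hv
  · exact hv
  · rw [coords_w] at h
    exact absurd (Subtype.ext h) (ht i).2
  · rw [c.coords_of_notMem hv] at h
    exact absurd h zero_ne_one

/-- At an interior point of a cube no `w_i` has coordinate `0`. -/
theorem mem_upper_iff_coords {n : ℕ} (c : K.SubdivCube n) {t : Fin n → unitInterval}
    (ht : ∀ i, t i ≠ 0 ∧ t i ≠ 1) (v : Fin N) : v ∈ c.upper ↔ c.coords t v ≠ 0 := by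
  refine ⟨fun h h0 => ?_, fun h => by_contra fun hv => h (c.coords_of_notMem hv)⟩
  rcases c.vertex_cases v with hv | ⟨i, rfl⟩ | hv
  · rw [c.coords_lower hv] at h0
    exact one_ne_zero h0
  · rw [coords_w] at h0
    exact (ht i).1 (Subtype.ext h0)
  · exact hv h

theorem realizationCoords_injective :
    Function.Injective (realizationCoords : K.cubicalSubdivision.Realization → Fin N → ℝ) := by
  intro p q h
  obtain ⟨n, c, t, ht, rfl⟩ := exists_interior_rep p
  obtain ⟨m, d, u, hu, rfl⟩ := exists_interior_rep q
  rw [realizationCoords_mk, realizationCoords_mk] at h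
  have hl : c.lower = d.lower := by
    ext v
    rw [mem_lower_iff_coords c ht, mem_lower_iff_coords d hu, h]
  have hup : c.upper = d.upper := by
    ext v
    rw [mem_upper_iff_coords c ht, mem_upper_iff_coords d hu, h]
  obtain rfl : n = m := by rw [← c.card_sdiff, ← d.card_sdiff, hl, hup]
  obtain rfl : c = d := SubdivCube.ext hl hup
  obtain rfl : t = u := by
    ext i
    rw [← coords_w c, ← coords_w c, h]
  rfl

/-- The required point lies in the cube `(τ, σ)` where `τ` and `σ` are the sets of vertices at which
`minSum x` is `1` and nonzero, respectively. -/
theorem exists_realizationCoords_eq {x : Fin N → ℝ} (hx : x ∈ K.polyhedron) :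
    ∃ p : K.cubicalSubdivision.Realization, realizationCoords p = minSum x := by
  obtain ⟨σ, hσ, hx⟩ := Set.mem_iUnion₂.1 hx
  obtain ⟨h0, h1, hs⟩ := mem_geomSimplex_iff.1 hx
  have hnn : ∀ v, 0 ≤ minSum x v := fun v => Finset.sum_nonneg fun u _ => le_min (h0 u) (h0 v)
  have hle : ∀ v, minSum x v ≤ 1 := fun v =>
    (Finset.sum_le_sum fun u _ => min_le_left _ _).trans h1.le
  have hσ' : ∀ v ∉ σ, minSum x v = 0 := fun v hv => Finset.sum_eq_zero fun u _ => by
    rw [hs v hv, min_eq_right (h0 u)]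
  let τ := Finset.univ.filter fun v => minSum x v = 1
  let ρ := Finset.univ.filter fun v => minSum x v ≠ 0
  have hτρ : τ ⊆ ρ := fun v hv => by
    simp only [τ, ρ, Finset.mem_filter, Finset.mem_univ, true_and] at hv ⊢
    rw [hv]
    exact one_ne_zero
  have hρσ : ρ ⊆ σ := fun v hv => by
    by_contra h
    exact (Finset.mem_filter.1 hv).2 (hσ' v h)
  -- `minSum x` is `1` where `x` attains its maximum.
  have hτ : τ.Nonempty := by
    obtain ⟨v, -, hv⟩ := Finset.exists_max_image σ x (K.isRelLowerSet_faces hσ).1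
    refine ⟨v, Finset.mem_filter.2 ⟨Finset.mem_univ v, ?_⟩⟩
    rw [← h1]
    refine Finset.sum_congr rfl fun u _ => min_eq_left ?_
    by_cases hu : u ∈ σ
    · exact hv u hu
    · rw [hs u hu]
      exact h0 v
  let c : K.SubdivCube (ρ \ τ).card :=
    { lower := τ
      upper := ρ
      lower_mem := (K.isRelLowerSet_faces hσ).2 (hτρ.trans hρσ) hτ
      upper_mem := (K.isRelLowerSet_faces hσ).2 hρσ (hτ.mono hτρ)
      lower_subset := hτρ
      card_sdiff := rfl }
  refine ⟨.mk (X := K.cubicalSubdivision) c fun i => ⟨minSum x (c.w i), hnn _, hle _⟩, ?_⟩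
  rw [realizationCoords_mk]
  ext v
  rcases c.vertex_cases v with hv | ⟨i, rfl⟩ | hv
  · rw [c.coords_lower hv, (Finset.mem_filter.1 hv).2]
  · rw [coords_w]
  · rw [c.coords_of_notMem hv]
    by_contra h
    exact hv (Finset.mem_filter.2 ⟨Finset.mem_univ v, Ne.symm h⟩)

theorem compactSpace_realization : CompactSpace K.cubicalSubdivision.Realization := by
  have : Finite (Σ n : ℕ, K.cubicalSubdivision.cube n) := by
    refine Finite.of_injective
      (fun x : Σ n : ℕ, K.SubdivCube n => (x.2.lower, x.2.upper)) ?_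
    rintro ⟨n, c⟩ ⟨m, d⟩ h
    obtain ⟨hl, hu⟩ := Prod.ext_iff.1 h
    dsimp only at hl hu
    obtain rfl : n = m := by rw [← c.card_sdiff, ← d.card_sdiff, hl, hu]
    rw [SubdivCube.ext hl hu]
  exact inferInstanceAs (CompactSpace (Quot K.cubicalSubdivision.FaceRel))

end AbstractSimplicialComplex

/-! ### The subdivision map -/

open AbstractSimplicialComplex in
/-- Each cube `[0,1]^n` is the union of the simplices `Δ_θ`; the formulas on the simplices of all
cubes define one and only one map `f : |P| → |K|`; this `f` is a homeomorphism, and it maps the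
simplex `Δ_θ` of the cube `(τ, σ)` onto the set of all convex combinations of the barycenters of
the faces `τ ∪ {w_{θ(1)}, …, w_{θ(j)}}`, `0 ≤ j ≤ n`, of `σ`. -/
theorem mainTheorem2 {N : ℕ} (K : AbstractSimplicialComplex (Fin N)) :
    (∀ n : ℕ, (⋃ θ : Equiv.Perm (Fin n), orderSimplex θ) = Set.univ) ∧
    ∃ f : K.cubicalSubdivision.Realization → K.polyhedron,
      AbstractSimplicialComplex.IsSubdivisionMap f ∧
      (∀ g : K.cubicalSubdivision.Realization → K.polyhedron,
        AbstractSimplicialComplex.IsSubdivisionMap g → g = f) ∧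
      IsHomeomorph f ∧
      (∀ (n : ℕ) (c : K.SubdivCube n) (θ : Equiv.Perm (Fin n)),
        (∀ j, c.flag θ j ∈ K ∧ c.flag θ j ⊆ c.upper) ∧
        (fun t : Fin n → unitInterval =>
            (f (.mk (X := K.cubicalSubdivision) c t) : Fin N → ℝ)) '' orderSimplex θ =
          convexHull ℝ
            (Set.range fun j => AbstractSimplicialComplex.barycenter (c.flag θ j))) := by
  have hsort : ∀ {n : ℕ} (t : Fin n → unitInterval), ∃ θ, t ∈ orderSimplex θ := fun {n} t =>
    Set.mem_iUnion.1 ((iUnion_orderSimplex n).symm ▸ Set.mem_univ t)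
  have hex : ∀ p : K.cubicalSubdivision.Realization,
      ∃ x : K.polyhedron, minSum (x : Fin N → ℝ) = realizationCoords p := by
    rintro ⟨⟨n, c⟩, t⟩
    obtain ⟨θ, hθ⟩ := hsort t
    exact ⟨⟨_, SubdivCube.mapFormula_mem c hθ⟩, SubdivCube.minSum_mapFormula c hθ⟩
  -- Since `minSum` is injective, `f` is the only map with `minSum ∘ f = realizationCoords`.
  choose f hf using hex
  have hG : Function.Injective fun x : K.polyhedron => minSum (x : Fin N → ℝ) :=
    minSum_injective.comp Subtype.val_injective
  have hGc : Continuous fun x : K.polyhedron => minSum (x : Fin N → ℝ) :=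
    continuous_minSum.comp continuous_subtype_val
  have hfmap : IsSubdivisionMap f := fun n c θ t ht => minSum_injective <| by
    rw [hf, SubdivCube.minSum_mapFormula c ht, realizationCoords_mk]
  have := isCompact_iff_compactSpace.1 K.isCompact_polyhedron
  have := compactSpace_realization (K := K)
  have hcont : Continuous f := by
    refine (hGc.isClosedEmbedding hG).isEmbedding.continuous_iff.2 ?_
    exact continuous_realizationCoords.congr fun p => (hf p).symm
  refine ⟨iUnion_orderSimplex, f, hfmap, fun g hg => ?_,
    isHomeomorph_iff_continuous_bijective.2 ⟨hcont, fun p q h => ?_, fun x => ?_⟩,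
    fun n c θ => ⟨fun j => ⟨c.flag_mem θ j, c.flag_subset_upper θ j⟩, ?_⟩⟩
  · funext p
    obtain ⟨⟨n, c⟩, t⟩ := p
    obtain ⟨θ, hθ⟩ := hsort t
    exact Subtype.ext ((hg n c θ t hθ).trans (hfmap n c θ t hθ).symm)
  · exact realizationCoords_injective (by rw [← hf, ← hf, h])
  · obtain ⟨p, hp⟩ := exists_realizationCoords_eq x.2
    exact ⟨p, hG ((hf p).trans hp)⟩
  · rw [← c.mapFormula_image θ]
    exact Set.image_congr fun t ht => hfmap n c θ t ht
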